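/- Let $A\to M$ be a smooth real vector bundle of finite rank over a smooth (Hausdorff, second countable) manifold, equipped with a Lie algebroid structure $\mu=([\cdot,\cdot],\rho)$ with differential $d$, and let $H\in\Gamma(\bigwedge^3A^*)$ with $dH=0$. Let $\pi\in\Gamma(\bigwedge^2A)$, $\sigma\in\Gamma(\bigwedge^2A^*)$, $N\in\Gamma(A\otimes A^*)$, and write $\pi^\sharp\alpha=\pi(\alpha,\cdot)$, $\sigma^\flat X=\sigma(X,\cdot)$, ${}^tN\alpha=\alpha\circ N$. Let $\lambda\in\{-1,0,1\}$ and $$J=\begin{pmatrix}N&\pi^\sharp\\ \sigma^\flat&-{}^tN\end{pmatrix}:A\oplus A^*\to A\oplus A^* .$$ On $\Gamma(A\oplus A^*)$ use the pairing $\langle X+\alpha,Y+\beta\rangle=\beta(X)+\alpha(Y)$ and the Dorfman bracket of $\mu+H$, $$[X+\alpha,Y+\beta]=[X,Y]+\mathcal L_X\beta-i_Yd\alpha-H(X,Y,\cdot).$$ $J$ is called a c.p.s. structure on $(A\oplus A^*,\mu+H)$ (with $J^2=\lambda\,\mathrm{id}$) if $\langle Ju,v\rangle+\langle u,Jv\rangle=0$,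 $J^2=\lambda\,\mathrm{id}$, and $[Ju,Jv]-J([Ju,v]+[u,Jv]-J[u,v])=0$ for all $u,v\in\Gamma(A\oplus A^*)$. For $\psi\in\Gamma(\bigwedge^3A^*)$, the quadruple $(\pi,N,\psi,H)$ is called a Poisson quasi-Nijenhuis structure with background $H$ if $N\pi^\sharp=\pi^\sharp\,{}^tN$, $d\psi=0$, $dH=0$, $[\pi,\pi]_{SN}=0$, and for all $X,Y\in\Gamma(A)$, $\alpha,\beta\in\Gamma(A^*)$ $$C_{\pi,N}(\alpha,\beta)=2H(\pi^\sharp\alpha,\pi^\sharp\beta,\cdot),$$ $$T_N(X,Y)=-\pi^\sharp\big(H(NX,Y,\cdot)-H(NY,X,\cdot)+\psi(X,Y,\cdot)\big),$$ $$d_N\psi=d\mathcal H .$$ Here $[X,Y]_N=[NX,Y]+[X,NY]-N[X,Y]$; $T_N(X,Y)=[NX,NY]-N[X,Y]_N$; $d_N$ is the differential given by the Koszul formula for the bracket $[\cdot,\cdot]_N$ and the anchor $\rho\circ N$; $\mathcal H(X,Y,Z)=H(NX,NY,Z)+H(NY,NZ,X)+H(NZ,NX,Y)$; $[\alpha,\beta]_\pi=\mathcal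 L_{\pi^\sharp\alpha}\beta-\mathcal L_{\pi^\sharp\beta}\alpha-d(\pi(\alpha,\beta))$; and $$C_{\pi,N}(\alpha,\beta)=([\alpha,\beta]_N)_\pi-\big([{}^tN\alpha,\beta]_\pi+[\alpha,{}^tN\beta]_\pi-{}^tN[\alpha,\beta]_\pi\big),$$ where $([\cdot,\cdot]_N)_\pi$ is the bracket $[\cdot,\cdot]_\pi$ formed with $([\cdot,\cdot]_N,\rho\circ N)$ in place of $([\cdot,\cdot],\rho)$. Theorem. $J$ is a c.p.s. structure on $(A\oplus A^*,\mu+H)$ with $J^2=\lambda\,\mathrm{id}$ if and only if $(\pi,N,-d\sigma,H)$ is a Poisson quasi-Nijenhuis structure with background $H$ and $$N^2+\pi^\sharp\sigma^\flat=\lambda\,\mathrm{id}_A,\qquad \sigma^\flat N={}^tN\sigma^\flat,\qquad 2(i_Nd\sigma-\mathcal H)=d(i_N\sigma)+2\lambda H,$$ where $i_N$ acts on forms by $(i_N\omega)(X_1,\dots,X_k)=\sum_j\omega(X_1,\dots,NX_j,\dots,X_k)$. -/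

import Mathlib

open scoped Manifold ContDiff

noncomputable section

namespace LieAlgebroidGeometry

universe uM uF uA

/-! ### Smooth functions, sections and tensor fields

`M` is a smooth manifold of dimension `n` and `A → M` a smooth vector bundle with fibre `F`.
Tensor fields are described, as usual, by `C^∞(M)`-multilinear maps on the modules of smooth
sections. -/

/-- The algebra `C^∞(M)`. -/
abbrev SmoothFn (n : ℕ) (M : Type uM) [TopologicalSpace M]
    [ChartedSpace (EuclideanSpace ℝ (Fin n)) M] : Type uM :=
  C^∞⟮𝓡 n, M; ℝ⟯

/-- The space `Γ(A)` of smooth sections of the vector bundle `A`. -/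
abbrev Sec (n : ℕ) {M : Type uM} [TopologicalSpace M]
    [ChartedSpace (EuclideanSpace ℝ (Fin n)) M]
    (F : Type uF) [NormedAddCommGroup F] [NormedSpace ℝ F]
    (A : M → Type uA) [TopologicalSpace (Bundle.TotalSpace F A)]
    [∀ x, TopologicalSpace (A x)] [FiberBundle F A] :=
  Cₛ^∞⟮𝓡 n; F, A⟯

/-- Smooth vector fields on `M`. -/
abbrev VecField (n : ℕ) (M : Type uM) [TopologicalSpace M]
    [ChartedSpace (EuclideanSpace ℝ (Fin n)) M] [IsManifold (𝓡 n) ∞ M] :=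
  Cₛ^∞⟮𝓡 n; EuclideanSpace ℝ (Fin n), fun x : M => TangentSpace (𝓡 n) x⟯

section Basic

variable {n : ℕ} {M : Type uM} [TopologicalSpace M]
  [ChartedSpace (EuclideanSpace ℝ (Fin n)) M]
  {F : Type uF} [NormedAddCommGroup F] [NormedSpace ℝ F]
  {A : M → Type uA} [TopologicalSpace (Bundle.TotalSpace F A)]
  [∀ x, AddCommGroup (A x)] [∀ x, Module ℝ (A x)] [∀ x, TopologicalSpace (A x)]
  [FiberBundle F A] [VectorBundle ℝ F A]

/-- Multiplication of a section by a smooth function. -/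
instance instSMulSec : SMul (SmoothFn n M) (Sec n F A) :=
  ⟨fun f s => ⟨fun x => f x • s x, f.contMDiff.smul_section s.contMDiff⟩⟩

@[simp] theorem smulSec_apply (f : SmoothFn n M) (s : Sec n F A) (x : M) :
    (f • s) x = f x • s x := rfl

/-- `Γ(A)` is a module over `C^∞(M)`. -/
instance instModuleSec : Module (SmoothFn n M) (Sec n F A) where
  one_smul s := by ext x; simp
  mul_smul f g s := by ext x; simp [mul_smul]
  smul_zero f := by ext x; simp
  smul_add f s t := by ext x; simp
  add_smul f g s := by ext x; simp [add_smul]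
  zero_smul s := by ext x; simp

instance instIsScalarTowerSec : IsScalarTower ℝ (SmoothFn n M) (Sec n F A) where
  smul_assoc r f s := by ext x; simp [mul_smul]

theorem mdiff_smoothFn (f : SmoothFn n M) (x : M) : MDifferentiableAt (𝓡 n) 𝓘(ℝ) f x :=
  (f.contMDiff x).mdifferentiableAt (by simp)

variable [IsManifold (𝓡 n) ∞ M]

theorem contMDiff_deriv (V : VecField n M) (f : SmoothFn n M) :
    ContMDiff (𝓡 n) 𝓘(ℝ) ∞ (fun x => mvfderiv (𝓡 n) f x (V x)) := by
  have h1 : ContMDiff (𝓡 n) 𝓘(ℝ).tangent ∞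
      (fun x => tangentMap (𝓡 n) 𝓘(ℝ) f ⟨x, V x⟩) :=
    (f.contMDiff.contMDiff_tangentMap (m := ∞) (by simp)).comp V.contMDiff
  exact (contMDiff_snd_tangentBundle_modelSpace ℝ 𝓘(ℝ)).comp h1

/-- The derivative `V(f)` of a smooth function `f` along a vector field `V`. -/
def VecField.deriv (V : VecField n M) (f : SmoothFn n M) : SmoothFn n M :=
  ⟨fun x => mvfderiv (𝓡 n) f x (V x), contMDiff_deriv V f⟩


theorem VecField.deriv_apply (V : VecField n M) (f : SmoothFn n M) (x : M) :
    V.deriv f x = mvfderiv (𝓡 n) f x (V x) := rfl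

theorem VecField.deriv_add (V : VecField n M) (f g : SmoothFn n M) :
    V.deriv (f + g) = V.deriv f + V.deriv g := by
  ext x
  have := mvfderiv_add (mdiff_smoothFn f x) (mdiff_smoothFn g x)
  simp [VecField.deriv_apply, this]

theorem VecField.deriv_mul (V : VecField n M) (f g : SmoothFn n M) :
    V.deriv (f * g) = f * V.deriv g + g * V.deriv f := by
  ext x
  have := mvfderiv_mul (mdiff_smoothFn f x) (mdiff_smoothFn g x)
  simp [VecField.deriv_apply, this]

theorem VecField.deriv_neg (V : VecField n M) (f : SmoothFn n M) :
    V.deriv (-f) = -V.deriv f := by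
  ext x
  have := mvfderiv_neg (I := 𝓡 n) (g := f) (x := x)
  simp [VecField.deriv_apply, this]

theorem VecField.deriv_zero (V : VecField n M) : V.deriv 0 = 0 := by
  simpa using V.deriv_add 0 0

theorem VecField.add_deriv (V W : VecField n M) (f : SmoothFn n M) :
    (V + W).deriv f = V.deriv f + W.deriv f := by
  ext x
  simp [VecField.deriv_apply]

theorem VecField.smul_deriv (g : SmoothFn n M) (V : VecField n M) (f : SmoothFn n M) :
    VecField.deriv (g • V) f = g * V.deriv f := by
  ext x
  simp [VecField.deriv_apply]

end Basic

section TensorFields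

variable (n : ℕ) {M : Type uM} [TopologicalSpace M]
  [ChartedSpace (EuclideanSpace ℝ (Fin n)) M]
  (F : Type uF) [NormedAddCommGroup F] [NormedSpace ℝ F]
  (A : M → Type uA) [TopologicalSpace (Bundle.TotalSpace F A)]
  [∀ x, AddCommGroup (A x)] [∀ x, Module ℝ (A x)] [∀ x, TopologicalSpace (A x)]
  [FiberBundle F A] [VectorBundle ℝ F A]

/-- `Γ(A*)`: the `C^∞(M)`-linear maps `Γ(A) → C^∞(M)`. -/
abbrev Cov := Sec n F A →ₗ[SmoothFn n M] SmoothFn n M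

/-- `Γ(A ⊗ A*)`: the `(1,1)`-tensors on `A`. -/
abbrev Endo := Sec n F A →ₗ[SmoothFn n M] Sec n F A

/-- `Γ(⋀² A*)`: alternating `C^∞(M)`-bilinear maps on `Γ(A)`. The linear map `σ.toLin` is `σ♭`,
that is `σ♭ X = σ(X, ·)`. -/
structure TwoForm where
  toLin : Sec n F A →ₗ[SmoothFn n M] Cov n F A
  alt : ∀ X, toLin X X = 0

/-- `Γ(⋀³ A*)`: alternating `C^∞(M)`-trilinear maps on `Γ(A)`. The element `H.toLin X Y` of `Γ(A*)`
is `H(X, Y, ·)`. -/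
structure ThreeForm where
  toLin : Sec n F A →ₗ[SmoothFn n M] Sec n F A →ₗ[SmoothFn n M] Cov n F A
  alt₁₂ : ∀ X Z, toLin X X Z = 0
  alt₂₃ : ∀ X Y, toLin X Y Y = 0

/-- `Γ(⋀² A)`: a bivector `π` is given by the map `π♯ : Γ(A*) → Γ(A)`, `π♯ α = π(α, ·)`, which is
skew. -/
structure Bivector where
  sharp : Cov n F A →ₗ[SmoothFn n M] Sec n F A
  skew : ∀ α : Cov n F A, α (sharp α) = 0

end TensorFields

section Operations

variable {n : ℕ} {M : Type uM} [TopologicalSpace M]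
  [ChartedSpace (EuclideanSpace ℝ (Fin n)) M]
  {F : Type uF} [NormedAddCommGroup F] [NormedSpace ℝ F]
  {A : M → Type uA} [TopologicalSpace (Bundle.TotalSpace F A)]
  [∀ x, AddCommGroup (A x)] [∀ x, Module ℝ (A x)] [∀ x, TopologicalSpace (A x)]
  [FiberBundle F A] [VectorBundle ℝ F A]

/-- The flat map `σ♭ X = σ(X, ·)`. -/
def TwoForm.flat (σ : TwoForm n F A) : Sec n F A →ₗ[SmoothFn n M] Cov n F A := σ.toLin

/-- The value `π(α, β) = β(π♯ α)`. -/
def Bivector.eval (π : Bivector n F A) (α β : Cov n F A) : SmoothFn n M := β (π.sharp α)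

/-- The transpose `ᵗN` acting on `Γ(A*)`: `(ᵗN α)(X) = α(N X)`. -/
def Endo.transpose (N : Endo n F A) : Cov n F A →ₗ[SmoothFn n M] Cov n F A where
  toFun α := α.comp N
  map_add' _ _ := rfl
  map_smul' _ _ := rfl

theorem smoothFn_eq_zero_of_eq_neg {f : SmoothFn n M} (h : f = -f) : f = 0 := by
  ext x
  have : f x = -f x := congrArg (fun g : SmoothFn n M => g x) h
  change f x = 0
  linarith

/-- A `2`-form from a skew function which is `C^∞(M)`-linear in the last argument. -/
def TwoForm.ofFun (f : Sec n F A → Sec n F A → SmoothFn n M)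
    (add : ∀ X Y Y', f X (Y + Y') = f X Y + f X Y')
    (smul : ∀ X (c : SmoothFn n M) Y, f X (c • Y) = c * f X Y)
    (skew : ∀ X Y, f X Y = -f Y X) : TwoForm n F A where
  toLin :=
    { toFun := fun X =>
        { toFun := f X
          map_add' := add X
          map_smul' := smul X }
      map_add' := fun X X' => by
        ext1 Y
        change f (X + X') Y = f X Y + f X' Y
        rw [skew, add, skew Y X, skew Y X']; ring
      map_smul' := fun c X => by
        ext1 Y
        change f (c • X) Y = c * f X Y
        rw [skew, smul, skew Y X]; ring }
  alt X := smoothFn_eq_zero_of_eq_neg (skew X X)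

/-- A `3`-form from a skew function which is `C^∞(M)`-linear in the last argument. -/
def ThreeForm.ofFun (f : Sec n F A → Sec n F A → Sec n F A → SmoothFn n M)
    (add : ∀ X Y Z Z', f X Y (Z + Z') = f X Y Z + f X Y Z')
    (smul : ∀ X Y (c : SmoothFn n M) Z, f X Y (c • Z) = c * f X Y Z)
    (skew₁₂ : ∀ X Y Z, f X Y Z = -f Y X Z)
    (skew₂₃ : ∀ X Y Z, f X Y Z = -f X Z Y) : ThreeForm n F A where
  toLin :=
    { toFun := fun X => (TwoForm.ofFun (f X) (add X) (smul X) (skew₂₃ X)).toLin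
      map_add' := fun X X' => by
        refine LinearMap.ext fun Y => LinearMap.ext fun Z => ?_
        change f (X + X') Y Z = f X Y Z + f X' Y Z
        rw [skew₁₂, skew₂₃, add, skew₂₃ Y Z X, skew₂₃ Y Z X', skew₁₂ Y X, skew₁₂ Y X']; ring
      map_smul' := fun c X => by
        refine LinearMap.ext fun Y => LinearMap.ext fun Z => ?_
        change f (c • X) Y Z = c * f X Y Z
        rw [skew₁₂, skew₂₃, smul, skew₂₃ Y Z X, skew₁₂ Y X]; ring }
  alt₁₂ X Z := smoothFn_eq_zero_of_eq_neg (skew₁₂ X X Z)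
  alt₂₃ X Y := smoothFn_eq_zero_of_eq_neg (skew₂₃ X Y Y)

theorem TwoForm.skew (σ : TwoForm n F A) (X Y : Sec n F A) :
    σ.toLin X Y = -σ.toLin Y X := by
  have h := σ.alt (X + Y)
  simp only [map_add, LinearMap.add_apply, σ.alt, zero_add, add_zero] at h
  exact eq_neg_of_add_eq_zero_right h

theorem ThreeForm.skew₁₂ (H : ThreeForm n F A) (X Y Z : Sec n F A) :
    H.toLin X Y Z = -H.toLin Y X Z := by
  have h := H.alt₁₂ (X + Y) Z
  simp only [map_add, LinearMap.add_apply, H.alt₁₂, zero_add, add_zero] at h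
  exact eq_neg_of_add_eq_zero_right h

theorem ThreeForm.skew₂₃ (H : ThreeForm n F A) (X Y Z : Sec n F A) :
    H.toLin X Y Z = -H.toLin X Z Y := by
  have h := H.alt₂₃ X (Y + Z)
  simp only [map_add, LinearMap.add_apply, H.alt₂₃, zero_add, add_zero] at h
  exact eq_neg_of_add_eq_zero_right h

instance : Neg (ThreeForm n F A) where
  neg H := .ofFun (fun X Y Z => -H.toLin X Y Z)
    (fun X Y Z Z' => by simp only [map_add]; ring)
    (fun X Y c Z => by simp only [map_smul, smul_eq_mul]; ring)
    (fun X Y Z => by rw [H.skew₁₂ X])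
    (fun X Y Z => by rw [H.skew₂₃ X])

/-- `(i_N σ)(X, Y) = σ(NX, Y) + σ(X, NY)`. -/
def TwoForm.contract (N : Endo n F A) (σ : TwoForm n F A) : TwoForm n F A :=
  .ofFun (fun X Y => σ.toLin (N X) Y + σ.toLin X (N Y))
    (fun X Y Y' => by simp only [map_add]; ring)
    (fun X c Y => by simp only [map_smul, smul_eq_mul]; ring)
    (fun X Y => by rw [σ.skew (N X), σ.skew X]; ring)

/-- `(i_N H)(X, Y, Z) = H(NX, Y, Z) + H(X, NY, Z) + H(X, Y, NZ)`. -/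
def ThreeForm.contract (N : Endo n F A) (H : ThreeForm n F A) : ThreeForm n F A :=
  .ofFun (fun X Y Z => H.toLin (N X) Y Z + H.toLin X (N Y) Z + H.toLin X Y (N Z))
    (fun X Y Z Z' => by simp only [map_add]; ring)
    (fun X Y c Z => by simp only [map_smul, smul_eq_mul]; ring)
    (fun X Y Z => by rw [H.skew₁₂ (N X), H.skew₁₂ X (N Y), H.skew₁₂ X Y]; ring)
    (fun X Y Z => by rw [H.skew₂₃ (N X), H.skew₂₃ X (N Y), H.skew₂₃ X Y]; ring)

/-- The `3`-form `ℋ(X, Y, Z) = H(NX, NY, Z) + H(NY, NZ, X) + H(NZ, NX, Y)`. -/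
def ThreeForm.contractTwice (N : Endo n F A) (H : ThreeForm n F A) : ThreeForm n F A :=
  .ofFun (fun X Y Z =>
      H.toLin (N X) (N Y) Z + H.toLin (N Y) (N Z) X + H.toLin (N Z) (N X) Y)
    (fun X Y Z Z' => by simp only [map_add, LinearMap.add_apply]; ring)
    (fun X Y c Z => by simp only [map_smul, LinearMap.smul_apply, smul_eq_mul]; ring)
    (fun X Y Z => by
      rw [H.skew₁₂ (N X) (N Y), H.skew₁₂ (N Y) (N Z), H.skew₁₂ (N Z) (N X)]; ring)
    (fun X Y Z => by
      rw [H.skew₁₂ (N X) (N Y), H.skew₁₂ (N Y) (N Z), H.skew₁₂ (N Z) (N X)]; ring)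

end Operations

/-! ### Lie algebroids and their calculus -/

section Algebroid

/-- A skew-symmetric bracket on `Γ(A)` with an anchor `ρ : A → TM` for which the Leibniz rule
`[X, fY] = f[X, Y] + ρ(X)(f) Y` holds; the Jacobi identity is not required. -/
structure SkewAlgebroid (n : ℕ) {M : Type uM} [TopologicalSpace M]
    [ChartedSpace (EuclideanSpace ℝ (Fin n)) M] [IsManifold (𝓡 n) ∞ M]
    (F : Type uF) [NormedAddCommGroup F] [NormedSpace ℝ F]
    (A : M → Type uA) [TopologicalSpace (Bundle.TotalSpace F A)]
    [∀ x, AddCommGroup (A x)] [∀ x, Module ℝ (A x)] [∀ x, TopologicalSpace (A x)]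
    [FiberBundle F A] [VectorBundle ℝ F A] where
  anchor : Sec n F A →ₗ[SmoothFn n M] VecField n M
  bracket : Sec n F A →ₗ[ℝ] Sec n F A →ₗ[ℝ] Sec n F A
  bracket_self : ∀ X, bracket X X = 0
  leibniz : ∀ X (f : SmoothFn n M) Y,
    bracket X (f • Y) = f • bracket X Y + (anchor X).deriv f • Y

/-- A Lie algebroid structure on `A`. -/
structure LieAlgebroid (n : ℕ) {M : Type uM} [TopologicalSpace M]
    [ChartedSpace (EuclideanSpace ℝ (Fin n)) M] [IsManifold (𝓡 n) ∞ M]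
    (F : Type uF) [NormedAddCommGroup F] [NormedSpace ℝ F]
    (A : M → Type uA) [TopologicalSpace (Bundle.TotalSpace F A)]
    [∀ x, AddCommGroup (A x)] [∀ x, Module ℝ (A x)] [∀ x, TopologicalSpace (A x)]
    [FiberBundle F A] [VectorBundle ℝ F A] extends SkewAlgebroid n F A where
  jacobi : ∀ X Y Z,
    bracket X (bracket Y Z) = bracket (bracket X Y) Z + bracket Y (bracket X Z)
  /-- The anchor is a morphism of brackets (this also follows from the other axioms). -/
  anchor_bracket : ∀ X Y (f : SmoothFn n M), (anchor (bracket X Y)).deriv f =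
    (anchor X).deriv ((anchor Y).deriv f) - (anchor Y).deriv ((anchor X).deriv f)

variable {n : ℕ} {M : Type uM} [TopologicalSpace M]
  [ChartedSpace (EuclideanSpace ℝ (Fin n)) M] [IsManifold (𝓡 n) ∞ M]
  {F : Type uF} [NormedAddCommGroup F] [NormedSpace ℝ F]
  {A : M → Type uA} [TopologicalSpace (Bundle.TotalSpace F A)]
  [∀ x, AddCommGroup (A x)] [∀ x, Module ℝ (A x)] [∀ x, TopologicalSpace (A x)]
  [FiberBundle F A] [VectorBundle ℝ F A]

namespace SkewAlgebroid

variable (B : SkewAlgebroid n F A)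

/-- `ρ(X)(f)`. -/
def act (X : Sec n F A) (f : SmoothFn n M) : SmoothFn n M := (B.anchor X).deriv f

theorem bracket_skew (X Y : Sec n F A) : B.bracket X Y = -B.bracket Y X := by
  have h := B.bracket_self (X + Y)
  simp only [map_add, LinearMap.add_apply, B.bracket_self, zero_add, add_zero] at h
  exact eq_neg_of_add_eq_zero_right h

theorem leibniz_act (X : Sec n F A) (f : SmoothFn n M) (Y : Sec n F A) :
    B.bracket X (f • Y) = f • B.bracket X Y + B.act X f • Y := B.leibniz X f Y

theorem act_add (X : Sec n F A) (f g : SmoothFn n M) :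
    B.act X (f + g) = B.act X f + B.act X g := VecField.deriv_add _ _ _

theorem act_neg (X : Sec n F A) (f : SmoothFn n M) :
    B.act X (-f) = -B.act X f := VecField.deriv_neg _ _

theorem act_mul (X : Sec n F A) (f g : SmoothFn n M) :
    B.act X (f * g) = f * B.act X g + g * B.act X f := VecField.deriv_mul _ _ _

theorem add_act (X Y : Sec n F A) (f : SmoothFn n M) :
    B.act (X + Y) f = B.act X f + B.act Y f := by
  simp only [act, map_add, VecField.add_deriv]

theorem smul_act (g : SmoothFn n M) (X : Sec n F A) (f : SmoothFn n M) :
    B.act (g • X) f = g * B.act X f := by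
  simp only [act, map_smul, VecField.smul_deriv]

/-- The differential of a function: `(df)(X) = ρ(X)(f)`. -/
def d₀ (f : SmoothFn n M) : Cov n F A where
  toFun X := B.act X f
  map_add' X Y := B.add_act X Y f
  map_smul' g X := B.smul_act g X f

/-- The differential of a `1`-form:
`(dα)(X, Y) = ρ(X)(α(Y)) - ρ(Y)(α(X)) - α([X, Y])`. -/
def d₁ (α : Cov n F A) : TwoForm n F A :=
  .ofFun (fun X Y => B.act X (α Y) - B.act Y (α X) - α (B.bracket X Y))
    (fun X Y Y' => by simp only [map_add, act_add, add_act]; ring)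
    (fun X c Y => by
      simp only [map_smul, smul_eq_mul, act_mul, smul_act, leibniz_act, map_add]; ring)
    (fun X Y => by rw [B.bracket_skew X Y, map_neg]; ring)

/-- The differential of a `2`-form:
`(dσ)(X, Y, Z) = ρ(X)(σ(Y, Z)) - ρ(Y)(σ(X, Z)) + ρ(Z)(σ(X, Y))
  - σ([X, Y], Z) + σ([X, Z], Y) - σ([Y, Z], X)`. -/
def d₂ (σ : TwoForm n F A) : ThreeForm n F A :=
  .ofFun (fun X Y Z => B.act X (σ.toLin Y Z) - B.act Y (σ.toLin X Z) + B.act Z (σ.toLin X Y)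
      - σ.toLin (B.bracket X Y) Z + σ.toLin (B.bracket X Z) Y - σ.toLin (B.bracket Y Z) X)
    (fun X Y Z Z' => by simp only [map_add, act_add, add_act, LinearMap.add_apply]; ring)
    (fun X Y c Z => by
      simp only [map_smul, smul_eq_mul, act_mul, smul_act, leibniz_act, map_add,
        LinearMap.add_apply, LinearMap.smul_apply]
      rw [σ.skew Z X, σ.skew Z Y]; ring)
    (fun X Y Z => by
      rw [B.bracket_skew X Y, σ.skew X Y, map_neg, act_neg, LinearMap.neg_apply]; ring)
    (fun X Y Z => by
      rw [B.bracket_skew Y Z, σ.skew Y Z, map_neg, act_neg, LinearMap.neg_apply]; ring)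

/-- The differential of a `3`-form, evaluated on four sections:
`(dH)(X₀, …, X₃) = ∑ᵢ (-1)ⁱ ρ(Xᵢ)(H(…, X̂ᵢ, …)) + ∑_{i<j} (-1)^{i+j} H([Xᵢ, Xⱼ], …)`. -/
def d₃ (H : ThreeForm n F A) (X₀ X₁ X₂ X₃ : Sec n F A) : SmoothFn n M :=
  B.act X₀ (H.toLin X₁ X₂ X₃) - B.act X₁ (H.toLin X₀ X₂ X₃)
    + B.act X₂ (H.toLin X₀ X₁ X₃) - B.act X₃ (H.toLin X₀ X₁ X₂)
    - H.toLin (B.bracket X₀ X₁) X₂ X₃ + H.toLin (B.bracket X₀ X₂) X₁ X₃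
    - H.toLin (B.bracket X₀ X₃) X₁ X₂ - H.toLin (B.bracket X₁ X₂) X₀ X₃
    + H.toLin (B.bracket X₁ X₃) X₀ X₂ - H.toLin (B.bracket X₂ X₃) X₀ X₁

/-- A `3`-form is closed when `dH = 0`. -/
def IsClosed (H : ThreeForm n F A) : Prop := ∀ X₀ X₁ X₂ X₃, B.d₃ H X₀ X₁ X₂ X₃ = 0

/-- The Lie derivative of a `1`-form: `L_X β = i_X dβ + d(β(X))`, equivalently
`(L_X β)(Y) = ρ(X)(β(Y)) - β([X, Y])`. -/
def lieDer (X : Sec n F A) (β : Cov n F A) : Cov n F A :=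
  (B.d₁ β).toLin X + B.d₀ (β X)

/-- The deformation by a `(1,1)`-tensor `N`: the bracket
`[X, Y]_N = [NX, Y] + [X, NY] - N[X, Y]` with the anchor `ρ ∘ N`. Its differential is `d_N`. -/
def deform (N : Endo n F A) : SkewAlgebroid n F A where
  anchor := B.anchor.comp N
  bracket :=
    B.bracket.comp (N.restrictScalars ℝ) + B.bracket.compl₂ (N.restrictScalars ℝ)
      - B.bracket.compr₂ (N.restrictScalars ℝ)
  bracket_self X := by
    simp only [LinearMap.sub_apply, LinearMap.add_apply, LinearMap.comp_apply,
      LinearMap.compl₂_apply, LinearMap.compr₂_apply, LinearMap.coe_restrictScalars,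
      B.bracket_self, map_zero]
    rw [B.bracket_skew X (N X)]
    simp
  leibniz X f Y := by
    simp only [LinearMap.sub_apply, LinearMap.add_apply, LinearMap.comp_apply,
      LinearMap.compl₂_apply, LinearMap.compr₂_apply, LinearMap.coe_restrictScalars,
      B.leibniz, map_smul, map_add]
    module

/-- The Nijenhuis torsion `T_N(X, Y) = [NX, NY] - N([NX, Y] + [X, NY] - N[X, Y])`. -/
def torsion (N : Endo n F A) (X Y : Sec n F A) : Sec n F A :=
  B.bracket (N X) (N Y) - N (B.bracket (N X) Y + B.bracket X (N Y) - N (B.bracket X Y))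

/-- The bracket `[α, β]_π = L_{π♯α} β - L_{π♯β} α - d(π(α, β))` on `Γ(A*)`. -/
def piBracket (π : Bivector n F A) (α β : Cov n F A) : Cov n F A :=
  B.lieDer (π.sharp α) β - B.lieDer (π.sharp β) α - B.d₀ (π.eval α β)

/-- The concomitant `C_{π,N} = ([·,·]_N)_π - ([·,·]_π)_{ᵗN}`. -/
def concomitant (π : Bivector n F A) (N : Endo n F A) (α β : Cov n F A) : Cov n F A :=
  (B.deform N).piBracket π α β -
    (B.piBracket π (N.transpose α) β + B.piBracket π α (N.transpose β)
      - N.transpose (B.piBracket π α β))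

/-- The Schouten–Nijenhuis bracket of two bivectors, as a trivector evaluated on three `1`-forms:
`[P, Q](α, β, γ)` is the cyclic sum of `(L_{P♯α} β)(Q♯γ) + (L_{Q♯α} β)(P♯γ)`.
On decomposable bivectors it is given by
`[X₁ ∧ X₂, Y₁ ∧ Y₂] = ∑ᵢⱼ (-1)^{i+j} [Xᵢ, Yⱼ] ∧ X_{3-i} ∧ Y_{3-j}`. -/
def schouten (P Q : Bivector n F A) (α β γ : Cov n F A) : SmoothFn n M :=
  (B.lieDer (P.sharp α) β (Q.sharp γ) + B.lieDer (Q.sharp α) β (P.sharp γ))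
    + (B.lieDer (P.sharp β) γ (Q.sharp α) + B.lieDer (Q.sharp β) γ (P.sharp α))
    + (B.lieDer (P.sharp γ) α (Q.sharp β) + B.lieDer (Q.sharp γ) α (P.sharp β))

/-- `π` is a Poisson bivector: `[π, π] = 0` for the Schouten–Nijenhuis bracket. -/
def IsPoisson (π : Bivector n F A) : Prop := ∀ α β γ, B.schouten π π α β γ = 0

/-- Poisson quasi-Nijenhuis structures with background `(π, N, ψ, H)`. -/
structure IsPoissonQuasiNijenhuis (π : Bivector n F A) (N : Endo n F A)
    (ψ H : ThreeForm n F A) : Prop where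
  sharp_comm : ∀ α, N (π.sharp α) = π.sharp (N.transpose α)
  closed_psi : B.IsClosed ψ
  closed_background : B.IsClosed H
  poisson : B.IsPoisson π
  concomitant_eq : ∀ α β,
    B.concomitant π N α β = (2 : ℝ) • H.toLin (π.sharp α) (π.sharp β)
  torsion_eq : ∀ X Y,
    B.torsion N X Y = -π.sharp (H.toLin (N X) Y - H.toLin (N Y) X + ψ.toLin X Y)
  d_psi : ∀ X₀ X₁ X₂ X₃,
    (B.deform N).d₃ ψ X₀ X₁ X₂ X₃ = B.d₃ (H.contractTwice N) X₀ X₁ X₂ X₃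

end SkewAlgebroid

/-! ### The Courant algebroid `A ⊕ A*` -/

variable (n F A) in
/-- `Γ(A ⊕ A*) = Γ(A) ⊕ Γ(A*)`. -/
abbrev GenSec := Sec n F A × Cov n F A

/-- The pairing `⟨X + α, Y + β⟩ = β(X) + α(Y)`. -/
def pairing (u v : GenSec n F A) : SmoothFn n M := v.2 u.1 + u.2 v.1

/-- The endomorphism of `A ⊕ A*` with matrix `(N, π♯; σ♭, -ᵗN)`. -/
def matrixEndo (π : Bivector n F A) (N : Endo n F A) (σ : TwoForm n F A) :
    GenSec n F A →ₗ[SmoothFn n M] GenSec n F A where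
  toFun u := (N u.1 + π.sharp u.2, σ.flat u.1 - N.transpose u.2)
  map_add' u v := by
    ext1
    · simp only [Prod.fst_add, Prod.snd_add, map_add]; abel
    · simp only [Prod.fst_add, Prod.snd_add, map_add]; abel
  map_smul' c u := by
    ext1
    · simp only [Prod.smul_fst, Prod.smul_snd, map_smul, smul_add, RingHom.id_apply]
    · simp only [Prod.smul_fst, Prod.smul_snd, map_smul, smul_sub, RingHom.id_apply]

namespace SkewAlgebroid

variable (B : SkewAlgebroid n F A)

/-- The Dorfman bracket of `(A ⊕ A*, μ + H)`, i.e. the derived bracket `{{u, μ + H}, v}`: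
`[X + α, Y + β] = [X, Y] + L_X β - i_Y dα - H(X, Y, ·)`. -/
def dorfman (H : ThreeForm n F A) (u v : GenSec n F A) : GenSec n F A :=
  (B.bracket u.1 v.1, B.lieDer u.1 v.2 - (B.d₁ u.2).toLin v.1 - H.toLin u.1 v.1)

/-- The Nijenhuis torsion of an endomorphism `J` of `A ⊕ A*`:
`T_J(u, v) = [Ju, Jv] - J([Ju, v] + [u, Jv] - J[u, v])`. -/
def courantTorsion (H : ThreeForm n F A) (J : GenSec n F A →ₗ[SmoothFn n M] GenSec n F A)
    (u v : GenSec n F A) : GenSec n F A :=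
  B.dorfman H (J u) (J v)
    - J (B.dorfman H (J u) v + B.dorfman H u (J v) - J (B.dorfman H u v))

/-- `J` is a c.p.s. structure on `(A ⊕ A*, μ + H)` with `J² = lam · id`: it is orthogonal and
integrable, and `lam ∈ {-1, 0, 1}`. -/
structure IsCPS (H : ThreeForm n F A) (lam : ℝ)
    (J : GenSec n F A →ₗ[SmoothFn n M] GenSec n F A) : Prop where
  lam_mem : lam = -1 ∨ lam = 0 ∨ lam = 1
  orthogonal : ∀ u v, pairing (J u) v + pairing u (J v) = 0
  sq : ∀ u, J (J u) = lam • u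
  integrable : ∀ u v, B.courantTorsion H J u v = 0

end SkewAlgebroid

end Algebroid

end LieAlgebroidGeometry

end

open LieAlgebroidGeometry

/-!
`J` is skew for the pairing by its very shape, and `J² = λ` is read off blockwise. Since the
symmetric part of the Dorfman bracket is `d⟨u, v⟩` and the pairing is invariant, `⟨T_J(u, v), w⟩` is
then totally skew; two of any three sections of `A` or `A*` are of the same kind, and `1`-forms
separate sections, so `T_J` vanishes as soon as it does on `A × A` and on `A* × A*`. On `A* × A*`
its components are `[π, π]` and `C_{π,N} - 2H(π♯·, π♯·, ·)` up to a factor `2`; on `A × A` they are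
the defects of the identity for `T_N` and, up to a factor `2`, of
`2(i_N dσ - ℋ) = d(i_N σ) + 2λH`. Finally, applying `d` to the last identity yields `d_N ψ = dℋ` for
`ψ = -dσ`, because `d² = 0`, `dH = 0` and `d_N = [i_N, d]`.
-/

namespace LieAlgebroidGeometry

section LocalTrivialization

open Bundle

variable {𝕜 : Type*} [NontriviallyNormedField 𝕜]
  {E : Type*} [NormedAddCommGroup E] [NormedSpace 𝕜 E]
  {E' : Type*} [TopologicalSpace E'] {I : ModelWithCorners 𝕜 E E'}
  {M : Type*} [TopologicalSpace M] [ChartedSpace E' M] {k : WithTop ℕ∞}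
  {F : Type*} [NormedAddCommGroup F] [NormedSpace 𝕜 F]
  {A : M → Type*} [TopologicalSpace (TotalSpace F A)]
  [∀ x, AddCommGroup (A x)] [∀ x, Module 𝕜 (A x)] [∀ x, TopologicalSpace (A x)]
  [FiberBundle F A] [VectorBundle 𝕜 F A] [ContMDiffVectorBundle k F A I]
  {G : Type*} [NormedAddCommGroup G] [NormedSpace 𝕜 G]

theorem contMDiff_smul_clm_linearMapAt
    (e : Trivialization F (TotalSpace.proj : TotalSpace F A → M)) [MemTrivializationAtlas e]
    {f : M → 𝕜} (hf : ContMDiff I 𝓘(𝕜) k f) (hfe : tsupport f ⊆ e.baseSet) (φ : F →L[𝕜] G)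
    {s : ∀ x, A x} (hs : ContMDiff I (I.prod 𝓘(𝕜, F)) k fun x => TotalSpace.mk' F x (s x)) :
    ContMDiff I 𝓘(𝕜, G) k fun x => f x • φ (e.linearMapAt 𝕜 x (s x)) := by
  refine contMDiff_of_tsupport fun x hx => (hf x).smul ?_
  have hxe : x ∈ e.baseSet := hfe (tsupport_smul_subset_left f _ hx)
  have hφ : ContMDiffAt I 𝓘(𝕜, G) k (fun y => φ (e ⟨y, s y⟩).2) x :=
    φ.contMDiff.contMDiffAt.comp x ((e.contMDiffAt_section_iff hxe).1 (hs x))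
  refine hφ.congr_of_eventuallyEq ?_
  filter_upwards [e.open_baseSet.mem_nhds hxe] with y hy
  rw [e.coe_linearMapAt_of_mem hy]

end LocalTrivialization

variable {n : ℕ} {M : Type*} [TopologicalSpace M] [ChartedSpace (EuclideanSpace ℝ (Fin n)) M]
  {F : Type*} [NormedAddCommGroup F] [NormedSpace ℝ F]
  {A : M → Type*} [TopologicalSpace (Bundle.TotalSpace F A)]
  [∀ x, AddCommGroup (A x)] [∀ x, Module ℝ (A x)] [∀ x, TopologicalSpace (A x)]
  [FiberBundle F A] [VectorBundle ℝ F A]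

@[simp] theorem Endo.transpose_apply (N : Endo n F A) (α : Cov n F A) (X : Sec n F A) :
    N.transpose α X = α (N X) := rfl

@[simp] theorem TwoForm.flat_apply (σ : TwoForm n F A) (X : Sec n F A) :
    σ.flat X = σ.toLin X := rfl

@[simp] theorem TwoForm.contract_apply (N : Endo n F A) (σ : TwoForm n F A) (X Y : Sec n F A) :
    (σ.contract N).toLin X Y = σ.toLin (N X) Y + σ.toLin X (N Y) := rfl

@[simp] theorem ThreeForm.neg_apply (H : ThreeForm n F A) (X Y : Sec n F A) :
    (-H).toLin X Y = -H.toLin X Y := rfl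

@[simp] theorem ThreeForm.contract_apply (N : Endo n F A) (H : ThreeForm n F A)
    (X Y Z : Sec n F A) : (H.contract N).toLin X Y Z =
      H.toLin (N X) Y Z + H.toLin X (N Y) Z + H.toLin X Y (N Z) := rfl

@[simp] theorem ThreeForm.contractTwice_apply (N : Endo n F A) (H : ThreeForm n F A)
    (X Y Z : Sec n F A) : (H.contractTwice N).toLin X Y Z =
      H.toLin (N X) (N Y) Z + H.toLin (N Y) (N Z) X + H.toLin (N Z) (N X) Y := rfl

theorem ThreeForm.toLin_swap (H : ThreeForm n F A) (X Y : Sec n F A) :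
    H.toLin X Y = -H.toLin Y X := LinearMap.ext (H.skew₁₂ X Y)

theorem Bivector.sharp_skew (π : Bivector n F A) (α β : Cov n F A) :
    α (π.sharp β) = -β (π.sharp α) := by
  have h := π.skew (α + β)
  simp only [map_add, LinearMap.add_apply, π.skew, zero_add, add_zero] at h
  exact eq_neg_of_add_eq_zero_right h

theorem TwoForm.flat_sharp_apply (σ : TwoForm n F A) (π : Bivector n F A) (α : Cov n F A)
    (X : Sec n F A) : σ.flat (π.sharp α) X = α (π.sharp (σ.flat X)) := by
  rw [π.sharp_skew, flat_apply, σ.skew, flat_apply]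

theorem pairing_comm (u v : GenSec n F A) : pairing u v = pairing v u := add_comm _ _

theorem pairing_add_left (u v w : GenSec n F A) :
    pairing (u + v) w = pairing u w + pairing v w := by
  simp only [pairing, Prod.fst_add, Prod.snd_add, map_add, LinearMap.add_apply]; ring

theorem pairing_neg_left (u v : GenSec n F A) : pairing (-u) v = -pairing u v := by
  simp only [pairing, Prod.fst_neg, Prod.snd_neg, map_neg, LinearMap.neg_apply]; ring

theorem pairing_sub_left (u v w : GenSec n F A) :
    pairing (u - v) w = pairing u w - pairing v w := by
  rw [sub_eq_add_neg, pairing_add_left, pairing_neg_left, ← sub_eq_add_neg]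

theorem pairing_smul_left (r : ℝ) (u v : GenSec n F A) :
    pairing (r • u) v = r • pairing u v := by
  simp only [pairing, Prod.smul_fst, Prod.smul_snd, LinearMap.map_smul_of_tower,
    LinearMap.smul_apply, smul_add]

theorem pairing_add_right (u v w : GenSec n F A) :
    pairing u (v + w) = pairing u v + pairing u w := by
  simp only [pairing_comm u, pairing_add_left]

theorem pairing_smul_right (r : ℝ) (u v : GenSec n F A) :
    pairing u (r • v) = r • pairing u v := by
  simp only [pairing_comm u, pairing_smul_left]

theorem pairing_map_map {lam : ℝ} {J : GenSec n F A →ₗ[SmoothFn n M] GenSec n F A}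
    (ho : ∀ u v, pairing (J u) v + pairing u (J v) = 0) (hs : ∀ u, J (J u) = lam • u)
    (u v : GenSec n F A) : pairing (J u) (J v) = -(lam • pairing u v) := by
  have h := ho u (J v)
  rw [hs, pairing_smul_right] at h
  exact eq_neg_of_add_eq_zero_left h

section MatrixEndo

variable {π : Bivector n F A} {N : Endo n F A} {σ : TwoForm n F A}

theorem matrixEndo_apply (u : GenSec n F A) :
    matrixEndo π N σ u = (N u.1 + π.sharp u.2, σ.flat u.1 - N.transpose u.2) := rfl

variable (π N σ) in
theorem orthogonal_matrixEndo (u v : GenSec n F A) :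
    pairing (matrixEndo π N σ u) v + pairing u (matrixEndo π N σ v) = 0 := by
  simp only [pairing, matrixEndo_apply, TwoForm.flat_apply, LinearMap.sub_apply, map_add,
    Endo.transpose_apply]
  rw [π.sharp_skew v.2, σ.skew u.1]
  ring

/- The lower right block `σ♭π♯ + ᵗN² = λ` is the transpose of the upper left one. -/
theorem flat_sharp_add_transpose_transpose {lam : ℝ}
    (hA : ∀ X, N (N X) + π.sharp (σ.flat X) = lam • X) (α : Cov n F A) :
    σ.flat (π.sharp α) + N.transpose (N.transpose α) = lam • α := by
  ext1 X
  rw [LinearMap.smul_apply, ← LinearMap.map_smul_of_tower α lam X, ← hA X, map_add, add_comm,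
    ← σ.flat_sharp_apply]
  rfl

theorem matrixEndo_sq_iff {lam : ℝ} :
    (∀ u, matrixEndo π N σ (matrixEndo π N σ u) = lam • u) ↔
      (∀ α, N (π.sharp α) = π.sharp (N.transpose α)) ∧
      (∀ X, N (N X) + π.sharp (σ.flat X) = lam • X) ∧
      (∀ X, σ.flat (N X) = N.transpose (σ.flat X)) := by
  have sq_apply (X : Sec n F A) (α : Cov n F A) :
      matrixEndo π N σ (matrixEndo π N σ (X, α)) =
        ((N (N X) + π.sharp (σ.flat X)) + (N (π.sharp α) - π.sharp (N.transpose α)),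
          (σ.flat (N X) - N.transpose (σ.flat X)) +
            (σ.flat (π.sharp α) + N.transpose (N.transpose α))) := by
    simp only [matrixEndo_apply, map_add, map_sub, Prod.mk.injEq]
    constructor <;> abel
  refine ⟨fun h => ⟨fun α => ?_, fun X => ?_, fun X => ?_⟩, ?_⟩
  · have h₁ := congrArg Prod.fst (h (0, α))
    simp only [sq_apply, map_zero, add_zero, zero_add, Prod.smul_mk, smul_zero] at h₁
    exact sub_eq_zero.1 h₁
  · simpa [sq_apply] using congrArg Prod.fst (h (X, 0))
  · have h₂ := congrArg Prod.snd (h (X, 0))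
    simp only [sq_apply, map_zero, add_zero, Prod.smul_mk, smul_zero] at h₂
    exact sub_eq_zero.1 h₂
  · rintro ⟨hc, hA, hσ⟩ ⟨X, α⟩
    rw [sq_apply, hA, hc, hσ, sub_self, sub_self, flat_sharp_add_transpose_transpose hA, add_zero,
      zero_add, Prod.smul_mk]

end MatrixEndo

variable [IsManifold (𝓡 n) ∞ M]

namespace SkewAlgebroid

section Calculus

variable (B : SkewAlgebroid n F A)

theorem act_zero (X : Sec n F A) : B.act X 0 = 0 := VecField.deriv_zero _

theorem zero_act (f : SmoothFn n M) : B.act 0 f = 0 := by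
  simpa using B.add_act 0 0 f

theorem act_sub (X : Sec n F A) (f g : SmoothFn n M) :
    B.act X (f - g) = B.act X f - B.act X g := by
  rw [sub_eq_add_neg, act_add, act_neg, ← sub_eq_add_neg]

theorem act_algebraMap (X : Sec n F A) (r : ℝ) :
    B.act X (algebraMap ℝ (SmoothFn n M) r) = 0 := by
  ext x
  change mvfderiv (𝓡 n) (fun _ : M => r) x _ = 0
  simp [mvfderiv_const]

theorem act_smul (X : Sec n F A) (r : ℝ) (f : SmoothFn n M) :
    B.act X (r • f) = r • B.act X f := by
  rw [Algebra.smul_def, act_mul, act_algebraMap, mul_zero, add_zero, ← Algebra.smul_def]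

@[simp] theorem d₀_apply (f : SmoothFn n M) (X : Sec n F A) : B.d₀ f X = B.act X f := rfl

@[simp] theorem d₁_apply (α : Cov n F A) (X Y : Sec n F A) :
    (B.d₁ α).toLin X Y = B.act X (α Y) - B.act Y (α X) - α (B.bracket X Y) := rfl

@[simp] theorem d₂_apply (σ : TwoForm n F A) (X Y Z : Sec n F A) :
    (B.d₂ σ).toLin X Y Z =
      B.act X (σ.toLin Y Z) - B.act Y (σ.toLin X Z) + B.act Z (σ.toLin X Y)
      - σ.toLin (B.bracket X Y) Z + σ.toLin (B.bracket X Z) Y - σ.toLin (B.bracket Y Z) X := rfl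

@[simp] theorem lieDer_apply (X : Sec n F A) (β : Cov n F A) (Y : Sec n F A) :
    B.lieDer X β Y = B.act X (β Y) - β (B.bracket X Y) := by
  simp only [lieDer, LinearMap.add_apply, d₁_apply, d₀_apply]; ring

theorem d₁_zero (X : Sec n F A) : (B.d₁ 0).toLin X = 0 := by
  ext1 Z; simp [act_zero]

theorem d₁_neg (α : Cov n F A) (X : Sec n F A) : (B.d₁ (-α)).toLin X = -(B.d₁ α).toLin X := by
  ext1 Z; simp [act_neg]; ring

theorem lieDer_zero_left (β : Cov n F A) : B.lieDer 0 β = 0 := by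
  ext1 Z; simp [zero_act]

theorem lieDer_zero_right (X : Sec n F A) : B.lieDer X 0 = 0 := by
  ext1 Z; simp [act_zero]

theorem lieDer_neg (X : Sec n F A) (β : Cov n F A) : B.lieDer X (-β) = -B.lieDer X β := by
  ext1 Z; simp [act_neg]; ring

theorem d₂_toLin (σ : TwoForm n F A) (X Y : Sec n F A) :
    (B.d₂ σ).toLin X Y =
      B.lieDer X (σ.flat Y) - (B.d₁ (σ.flat X)).toLin Y - σ.flat (B.bracket X Y) := by
  ext1 Z
  simp only [LinearMap.sub_apply, lieDer_apply, d₁_apply, d₂_apply, TwoForm.flat_apply]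
  rw [σ.skew Y (B.bracket X Z), σ.skew X (B.bracket Y Z)]
  ring

theorem deform_act (N : Endo n F A) (X : Sec n F A) (f : SmoothFn n M) :
    (B.deform N).act X f = B.act (N X) f := rfl

theorem deform_bracket (N : Endo n F A) (X Y : Sec n F A) :
    (B.deform N).bracket X Y = B.bracket (N X) Y + B.bracket X (N Y) - N (B.bracket X Y) := rfl

/- This is `d_N = [i_N, d]`. -/
theorem deform_d₃ (N : Endo n F A) (K : ThreeForm n F A) (X₀ X₁ X₂ X₃ : Sec n F A) :
    (B.deform N).d₃ K X₀ X₁ X₂ X₃ =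
      B.d₃ K (N X₀) X₁ X₂ X₃ + B.d₃ K X₀ (N X₁) X₂ X₃ + B.d₃ K X₀ X₁ (N X₂) X₃
        + B.d₃ K X₀ X₁ X₂ (N X₃) - B.d₃ (K.contract N) X₀ X₁ X₂ X₃ := by
  simp only [d₃, deform_act, deform_bracket, ThreeForm.contract_apply, act_add, map_add, map_sub,
    LinearMap.add_apply, LinearMap.sub_apply]
  ring

theorem d₃_neg (K : ThreeForm n F A) (X₀ X₁ X₂ X₃ : Sec n F A) :
    B.d₃ (-K) X₀ X₁ X₂ X₃ = -B.d₃ K X₀ X₁ X₂ X₃ := by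
  simp only [d₃, ThreeForm.neg_apply, LinearMap.neg_apply, act_neg]
  ring

variable {B}

theorem IsClosed.neg {K : ThreeForm n F A} (hK : B.IsClosed K) : B.IsClosed (-K) :=
  fun X₀ X₁ X₂ X₃ => by rw [d₃_neg, hK, neg_zero]

theorem IsClosed.deform_d₃ {K : ThreeForm n F A} (hK : B.IsClosed K) (N : Endo n F A)
    (X₀ X₁ X₂ X₃ : Sec n F A) :
    (B.deform N).d₃ K X₀ X₁ X₂ X₃ = -B.d₃ (K.contract N) X₀ X₁ X₂ X₃ := by
  simp only [SkewAlgebroid.deform_d₃, hK _ _ _ _, add_zero, zero_sub]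

theorem d₃_eq_of_smul_sub_eq {K L P Q : ThreeForm n F A} {r s : ℝ} (hr : r ≠ 0)
    (hP : B.IsClosed P) (hQ : B.IsClosed Q)
    (h : ∀ X Y Z, r • (K.toLin X Y Z - L.toLin X Y Z) = P.toLin X Y Z + s • Q.toLin X Y Z)
    (X₀ X₁ X₂ X₃ : Sec n F A) : B.d₃ K X₀ X₁ X₂ X₃ = B.d₃ L X₀ X₁ X₂ X₃ := by
  have hK (X Y Z : Sec n F A) : K.toLin X Y Z =
      L.toLin X Y Z + r⁻¹ • (P.toLin X Y Z + s • Q.toLin X Y Z) := by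
    rw [← h, inv_smul_smul₀ hr, add_sub_cancel]
  have hd : B.d₃ K X₀ X₁ X₂ X₃ =
      B.d₃ L X₀ X₁ X₂ X₃ + r⁻¹ • (B.d₃ P X₀ X₁ X₂ X₃ + s • B.d₃ Q X₀ X₁ X₂ X₃) := by
    simp only [d₃, hK, act_add, act_smul]
    module
  rw [hd, hP, hQ, smul_zero, add_zero, smul_zero, add_zero]

end Calculus

end SkewAlgebroid

namespace LieAlgebroid

variable (μ : LieAlgebroid n F A)

theorem bracket_act (X Y : Sec n F A) (f : SmoothFn n M) :
    μ.act (μ.bracket X Y) f = μ.act X (μ.act Y f) - μ.act Y (μ.act X f) :=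
  μ.anchor_bracket X Y f

theorem bracket_bracket (X Y Z : Sec n F A) :
    μ.bracket (μ.bracket Y Z) X = μ.bracket (μ.bracket X Z) Y - μ.bracket (μ.bracket X Y) Z := by
  rw [μ.bracket_skew _ X, μ.jacobi, μ.bracket_skew Y (μ.bracket X Z)]
  abel

theorem isClosed_d₂ (σ : TwoForm n F A) : μ.IsClosed (μ.d₂ σ) := by
  intro X₀ X₁ X₂ X₃
  have jacobi_left (X Y Z W : Sec n F A) : σ.toLin (μ.bracket (μ.bracket Y Z) X) W =
      σ.toLin (μ.bracket (μ.bracket X Z) Y) W - σ.toLin (μ.bracket (μ.bracket X Y) Z) W := by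
    rw [μ.bracket_bracket, map_sub, LinearMap.sub_apply]
  have act_swap (X Y Z W : Sec n F A) : μ.act W (σ.toLin (μ.bracket X Y) Z) =
      -μ.act W (σ.toLin Z (μ.bracket X Y)) := by
    rw [σ.skew, SkewAlgebroid.act_neg]
  simp only [SkewAlgebroid.d₃, SkewAlgebroid.d₂_apply, SkewAlgebroid.act_add,
    SkewAlgebroid.act_sub, bracket_act]
  rw [jacobi_left X₀ X₁ X₂, jacobi_left X₀ X₁ X₃, jacobi_left X₀ X₂ X₃, jacobi_left X₁ X₂ X₃,
    σ.skew (μ.bracket X₂ X₃) (μ.bracket X₀ X₁), σ.skew (μ.bracket X₁ X₃) (μ.bracket X₀ X₂),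
    σ.skew (μ.bracket X₁ X₂) (μ.bracket X₀ X₃)]
  simp only [act_swap]
  ring

theorem deform_d₃_neg_d₂ {H : ThreeForm n F A} {N : Endo n F A} {σ : TwoForm n F A} {lam : ℝ}
    (hH : μ.IsClosed H)
    (h : ∀ X Y Z,
      (2 : ℝ) • (((μ.d₂ σ).contract N).toLin X Y Z - (H.contractTwice N).toLin X Y Z) =
        (μ.d₂ (σ.contract N)).toLin X Y Z + (2 * lam) • H.toLin X Y Z)
    (X₀ X₁ X₂ X₃ : Sec n F A) :
    (μ.deform N).d₃ (-(μ.d₂ σ)) X₀ X₁ X₂ X₃ = μ.d₃ (H.contractTwice N) X₀ X₁ X₂ X₃ := by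
  rw [SkewAlgebroid.d₃_neg, (μ.isClosed_d₂ σ).deform_d₃, neg_neg]
  exact SkewAlgebroid.d₃_eq_of_smul_sub_eq two_ne_zero (μ.isClosed_d₂ _) hH h X₀ X₁ X₂ X₃

end LieAlgebroid

namespace SkewAlgebroid

section Dorfman

variable (B : SkewAlgebroid n F A) (H : ThreeForm n F A)

theorem dorfman_add_left (u u' v : GenSec n F A) :
    B.dorfman H (u + u') v = B.dorfman H u v + B.dorfman H u' v := by
  refine Prod.ext ?_ (LinearMap.ext fun Z => ?_)
  · simp [dorfman]
  · simp [dorfman, act_add, add_act]; ring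

theorem dorfman_add_right (u v v' : GenSec n F A) :
    B.dorfman H u (v + v') = B.dorfman H u v + B.dorfman H u v' := by
  refine Prod.ext ?_ (LinearMap.ext fun Z => ?_)
  · simp [dorfman]
  · simp [dorfman, act_add]; ring

theorem pairing_dorfman_add_pairing_dorfman (u v w : GenSec n F A) :
    pairing (B.dorfman H u v) w + pairing v (B.dorfman H u w) = B.act u.1 (pairing v w) := by
  simp only [pairing, dorfman, LinearMap.sub_apply, lieDer_apply, d₁_apply, act_add]
  rw [H.skew₂₃ u.1 v.1 w.1, B.bracket_skew w.1 v.1, map_neg]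
  ring

theorem dorfman_add_dorfman_swap (u v : GenSec n F A) :
    B.dorfman H u v + B.dorfman H v u = (0, B.d₀ (pairing u v)) := by
  refine Prod.ext ?_ (LinearMap.ext fun Z => ?_)
  · simp [dorfman, B.bracket_skew v.1 u.1]
  · simp only [dorfman, Prod.mk_add_mk, LinearMap.add_apply, LinearMap.sub_apply, lieDer_apply,
      d₁_apply, d₀_apply, pairing, act_add]
    rw [H.skew₁₂ u.1 v.1]
    ring

end Dorfman

section TorsionSymmetry

variable {B : SkewAlgebroid n F A} {H : ThreeForm n F A} {lam : ℝ}
  {J : GenSec n F A →ₗ[SmoothFn n M] GenSec n F A}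

theorem courantTorsion_add_left (u u' v : GenSec n F A) :
    B.courantTorsion H J (u + u') v = B.courantTorsion H J u v + B.courantTorsion H J u' v := by
  simp only [courantTorsion, map_add, map_sub, dorfman_add_left]; abel

theorem courantTorsion_add_right (u v v' : GenSec n F A) :
    B.courantTorsion H J u (v + v') = B.courantTorsion H J u v + B.courantTorsion H J u v' := by
  simp only [courantTorsion, map_add, map_sub, dorfman_add_right]; abel

/- The symmetric part of the Dorfman bracket is `d⟨u, v⟩`, so the symmetric part of the torsion is
`d⟨Ju, Jv⟩ - J d(⟨Ju, v⟩ + ⟨u, Jv⟩) + J² d⟨u, v⟩`. -/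
theorem courantTorsion_swap (ho : ∀ u v, pairing (J u) v + pairing u (J v) = 0)
    (hs : ∀ u, J (J u) = lam • u) (u v : GenSec n F A) :
    B.courantTorsion H J u v = -B.courantTorsion H J v u := by
  have d_map_map : ((0, B.d₀ (pairing (J u) (J v))) : GenSec n F A) =
      -(lam • (0, B.d₀ (pairing u v))) := by
    rw [pairing_map_map ho hs]
    refine Prod.ext (by simp) (LinearMap.ext fun Z => ?_)
    simp [act_neg, act_smul]
  have d_map_add :
      ((0, B.d₀ (pairing (J u) v)) : GenSec n F A) + (0, B.d₀ (pairing u (J v))) = 0 := by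
    refine Prod.ext (by simp) (LinearMap.ext fun Z => ?_)
    simp [← act_add, ho, act_zero]
  refine eq_neg_of_add_eq_zero_left ?_
  calc B.courantTorsion H J u v + B.courantTorsion H J v u
      = (B.dorfman H (J u) (J v) + B.dorfman H (J v) (J u))
          - J ((B.dorfman H (J u) v + B.dorfman H v (J u))
            + (B.dorfman H u (J v) + B.dorfman H (J v) u))
          + J (J (B.dorfman H u v + B.dorfman H v u)) := by
        simp only [courantTorsion, map_add, map_sub]; abel
    _ = 0 := by
        simp only [dorfman_add_dorfman_swap, d_map_map, d_map_add, hs]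
        simp

theorem pairing_courantTorsion (ho : ∀ u v, pairing (J u) v + pairing u (J v) = 0)
    (hs : ∀ u, J (J u) = lam • u) (u v w : GenSec n F A) :
    pairing (B.courantTorsion H J u v) w =
      pairing (B.dorfman H (J u) (J v)) w + pairing (B.dorfman H (J u) v) (J w)
        + pairing (B.dorfman H u (J v)) (J w) + lam • pairing (B.dorfman H u v) w := by
  have pairing_map (a : GenSec n F A) : pairing (J a) w = -pairing a (J w) :=
    eq_neg_of_add_eq_zero_left (ho a w)
  simp only [courantTorsion, map_sub, map_add, hs, pairing_sub_left, pairing_add_left,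
    pairing_smul_left, pairing_map]
  ring

theorem pairing_courantTorsion_swap (ho : ∀ u v, pairing (J u) v + pairing u (J v) = 0)
    (hs : ∀ u, J (J u) = lam • u) (u v w : GenSec n F A) :
    pairing (B.courantTorsion H J u v) w = -pairing (B.courantTorsion H J u w) v := by
  have h₁ := B.pairing_dorfman_add_pairing_dorfman H (J u) (J v) w
  have h₂ := B.pairing_dorfman_add_pairing_dorfman H (J u) v (J w)
  have h₃ := B.pairing_dorfman_add_pairing_dorfman H u (J v) (J w)
  have h₄ := congrArg (lam • ·) (B.pairing_dorfman_add_pairing_dorfman H u v w)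
  have act_skew : B.act (J u).1 (pairing (J v) w) + B.act (J u).1 (pairing v (J w)) = 0 := by
    rw [← act_add, ho, act_zero]
  rw [pairing_map_map ho hs, act_neg, act_smul] at h₃
  simp only [smul_add] at h₄
  rw [pairing_courantTorsion ho hs, pairing_courantTorsion ho hs u w,
    pairing_comm (B.dorfman H (J u) (J w)), pairing_comm (B.dorfman H (J u) w),
    pairing_comm (B.dorfman H u (J w)), pairing_comm (B.dorfman H u w)]
  linear_combination h₁ + h₂ + h₃ + h₄ + act_skew

end TorsionSymmetry

section MatrixTorsion

variable (B : SkewAlgebroid n F A) (H : ThreeForm n F A)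
  {π : Bivector n F A} {N : Endo n F A} {σ : TwoForm n F A} {lam : ℝ}

theorem piBracket_eq (π : Bivector n F A) (α β : Cov n F A) :
    B.piBracket π α β = B.lieDer (π.sharp α) β - (B.d₁ α).toLin (π.sharp β) := by
  ext1 Z
  simp only [piBracket, Bivector.eval, LinearMap.sub_apply, lieDer_apply, d₁_apply, d₀_apply]
  rw [π.sharp_skew α β, act_neg]
  ring

theorem schouten_self (π : Bivector n F A) (α β γ : Cov n F A) :
    B.schouten π π α β γ =
      (2 : ℝ) • γ (B.bracket (π.sharp α) (π.sharp β) - π.sharp (B.piBracket π α β)) := by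
  rw [map_sub, π.sharp_skew γ, piBracket_eq]
  simp only [schouten, lieDer_apply, d₁_apply, LinearMap.sub_apply, two_smul]
  rw [π.sharp_skew γ α, π.sharp_skew α β, B.bracket_skew (π.sharp β) (π.sharp α),
    B.bracket_skew (π.sharp γ) (π.sharp β)]
  simp only [act_neg, map_neg]
  ring

theorem concomitant_eq_two_smul (hc : ∀ α, N (π.sharp α) = π.sharp (N.transpose α))
    (α β : Cov n F A) :
    B.concomitant π N α β =
      (2 : ℝ) • ((B.d₁ (N.transpose α)).toLin (π.sharp β) - B.lieDer (π.sharp α) (N.transpose β)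
        + N.transpose (B.piBracket π α β)) := by
  ext1 Z
  simp only [concomitant, piBracket_eq, LinearMap.sub_apply, LinearMap.add_apply,
    Endo.transpose_apply, lieDer_apply, d₁_apply, deform_act, deform_bracket, map_add, map_sub,
    ← hc, two_smul]
  ring

theorem courantTorsion_cov_cov (α β : Cov n F A) :
    B.courantTorsion H (matrixEndo π N σ) (0, α) (0, β) =
      (B.bracket (π.sharp α) (π.sharp β) - π.sharp (B.piBracket π α β),
        (B.d₁ (N.transpose α)).toLin (π.sharp β) - B.lieDer (π.sharp α) (N.transpose β)
          + N.transpose (B.piBracket π α β) - H.toLin (π.sharp α) (π.sharp β)) := by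
  simp only [courantTorsion, dorfman, matrixEndo_apply, map_zero, zero_add, zero_sub, lieDer_neg,
    d₁_neg, LinearMap.zero_apply, lieDer_zero_left, sub_zero, Prod.mk_add_mk, add_zero, neg_zero,
    Prod.mk_sub_mk, piBracket_eq, ← sub_eq_add_neg, Prod.mk.injEq, true_and]
  abel

/- Here `N.transpose (H.toLin X Y)` is `H(X, Y, N ·)`. -/
theorem dorfman_matrixEndo_sec_sec (X Y : Sec n F A) :
    B.dorfman H (matrixEndo π N σ (X, 0)) (Y, 0) + B.dorfman H (X, 0) (matrixEndo π N σ (Y, 0))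
        - matrixEndo π N σ (B.dorfman H (X, 0) (Y, 0)) =
      ((B.deform N).bracket X Y + π.sharp (H.toLin X Y),
        (B.d₂ σ).toLin X Y - H.toLin (N X) Y - H.toLin X (N Y) - N.transpose (H.toLin X Y)) := by
  simp only [dorfman, matrixEndo_apply, map_zero, add_zero, sub_zero, Prod.mk_add_mk,
    Prod.mk_sub_mk, lieDer_zero_right, d₁_zero, zero_sub, map_neg, deform_bracket, d₂_toLin,
    Prod.mk.injEq]
  constructor <;> abel

theorem courantTorsion_sec_sec (X Y : Sec n F A) :
    B.courantTorsion H (matrixEndo π N σ) (X, 0) (Y, 0) =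
      (B.bracket (N X) (N Y) - N ((B.deform N).bracket X Y + π.sharp (H.toLin X Y))
          - π.sharp ((B.d₂ σ).toLin X Y - H.toLin (N X) Y - H.toLin X (N Y)
            - N.transpose (H.toLin X Y)),
        B.lieDer (N X) (σ.flat Y) - (B.d₁ (σ.flat X)).toLin (N Y) - H.toLin (N X) (N Y)
          - σ.flat ((B.deform N).bracket X Y + π.sharp (H.toLin X Y))
          + N.transpose ((B.d₂ σ).toLin X Y - H.toLin (N X) Y - H.toLin X (N Y)
            - N.transpose (H.toLin X Y))) := by
  rw [courantTorsion, dorfman_matrixEndo_sec_sec]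
  simp only [dorfman, matrixEndo_apply, map_zero, add_zero, sub_zero, Prod.mk_sub_mk,
    Prod.mk.injEq]
  constructor <;> abel

theorem courantTorsion_sec_sec_fst (hc : ∀ α, N (π.sharp α) = π.sharp (N.transpose α))
    (X Y : Sec n F A) :
    (B.courantTorsion H (matrixEndo π N σ) (X, 0) (Y, 0)).1 =
      B.torsion N X Y +
        π.sharp (H.toLin (N X) Y - H.toLin (N Y) X + (-(B.d₂ σ)).toLin X Y) := by
  rw [courantTorsion_sec_sec, H.toLin_swap (N Y) X]
  simp only [torsion, deform_bracket, ThreeForm.neg_apply, map_add, map_sub, map_neg, hc]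
  abel

/- By `hσ`, `i_N σ = 2 σ(N ·, ·)`; this is where the factor `2` comes from. -/
theorem two_smul_lieDer_sub_d₁_sub_flat (hσ : ∀ X, σ.flat (N X) = N.transpose (σ.flat X))
    (X Y Z : Sec n F A) :
    (2 : ℝ) • (B.lieDer (N X) (σ.flat Y) - (B.d₁ (σ.flat X)).toLin (N Y)
        - σ.flat ((B.deform N).bracket X Y) + N.transpose ((B.d₂ σ).toLin X Y)) Z =
      (2 : ℝ) • ((B.d₂ σ).contract N).toLin X Y Z - (B.d₂ (σ.contract N)).toLin X Y Z := by
  have flat_map (X Y : Sec n F A) : σ.toLin (N X) Y = σ.toLin X (N Y) :=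
    LinearMap.congr_fun (hσ X) Y
  simp only [LinearMap.add_apply, LinearMap.sub_apply, lieDer_apply, d₁_apply, d₂_apply,
    deform_bracket, TwoForm.flat_apply, Endo.transpose_apply, ThreeForm.contract_apply,
    TwoForm.contract_apply, act_add, map_add, map_sub, two_smul, flat_map]
  rw [σ.skew Y (B.bracket (N X) Z), σ.skew X (B.bracket (N Y) Z)]
  ring

theorem two_smul_courantTorsion_sec_sec_snd
    (hA : ∀ X, N (N X) + π.sharp (σ.flat X) = lam • X)
    (hσ : ∀ X, σ.flat (N X) = N.transpose (σ.flat X)) (X Y Z : Sec n F A) :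
    (2 : ℝ) • (B.courantTorsion H (matrixEndo π N σ) (X, 0) (Y, 0)).2 Z =
      (2 : ℝ) • (((B.d₂ σ).contract N).toLin X Y Z - (H.contractTwice N).toLin X Y Z) -
        ((B.d₂ (σ.contract N)).toLin X Y Z + (2 * lam) • H.toLin X Y Z) := by
  have hHN : H.toLin (N X) (N Y) Z + H.toLin (N X) Y (N Z) + H.toLin X (N Y) (N Z) =
      (H.contractTwice N).toLin X Y Z := by
    rw [ThreeForm.contractTwice_apply, H.skew₁₂ (N Z), H.skew₂₃ (N X) (N Z), H.skew₂₃ (N Y) (N Z),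
      H.skew₁₂ (N Y) X]
    ring
  have hHlam := LinearMap.congr_fun (flat_sharp_add_transpose_transpose hA (H.toLin X Y)) Z
  have hdσ := B.two_smul_lieDer_sub_d₁_sub_flat hσ X Y Z
  rw [courantTorsion_sec_sec]
  simp only [map_add, map_sub, LinearMap.add_apply, LinearMap.sub_apply, LinearMap.smul_apply,
    Endo.transpose_apply] at hHlam hdσ ⊢
  linear_combination (norm := module) hdσ - (2 : ℝ) • hHN - (2 : ℝ) • hHlam

theorem forall_courantTorsion_sec_sec_eq_zero_iff
    (hc : ∀ α, N (π.sharp α) = π.sharp (N.transpose α))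
    (hA : ∀ X, N (N X) + π.sharp (σ.flat X) = lam • X)
    (hσ : ∀ X, σ.flat (N X) = N.transpose (σ.flat X)) :
    (∀ X Y, B.courantTorsion H (matrixEndo π N σ) (X, 0) (Y, 0) = 0) ↔
      (∀ X Y, B.torsion N X Y =
        -π.sharp (H.toLin (N X) Y - H.toLin (N Y) X + (-(B.d₂ σ)).toLin X Y)) ∧
      (∀ X Y Z,
        (2 : ℝ) • (((B.d₂ σ).contract N).toLin X Y Z - (H.contractTwice N).toLin X Y Z) =
          (B.d₂ (σ.contract N)).toLin X Y Z + (2 * lam) • H.toLin X Y Z) := by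
  simp only [Prod.ext_iff, LinearMap.ext_iff, forall_and, courantTorsion_sec_sec_fst B H hc,
    Prod.fst_zero, Prod.snd_zero, LinearMap.zero_apply, add_eq_zero_iff_eq_neg]
  refine and_congr_right fun _ => forall₃_congr fun X Y Z => ?_
  rw [← smul_eq_zero_iff_right (two_ne_zero (α := ℝ)),
    two_smul_courantTorsion_sec_sec_snd B H hA hσ, sub_eq_zero]

end MatrixTorsion

end SkewAlgebroid

variable [T2Space M] [ContMDiffVectorBundle ∞ F A (𝓡 n)]

/-- The `1`-form on `A` that is `f φ` in the trivialization `e`, for a linear functional `φ` on the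
fibre and a cut-off function `f` supported in the base set of `e`; it is extended by zero. -/
noncomputable def cutoffCov
    (e : Bundle.Trivialization F (Bundle.TotalSpace.proj : Bundle.TotalSpace F A → M))
    [MemTrivializationAtlas e] (f : SmoothFn n M) (hf : tsupport f ⊆ e.baseSet)
    (φ : F →L[ℝ] ℝ) : Cov n F A where
  toFun s := ⟨_, contMDiff_smul_clm_linearMapAt e f.contMDiff hf φ s.contMDiff⟩
  map_add' s t := by
    ext x
    change f x • φ (e.linearMapAt ℝ x (s x + t x)) =
      f x • φ (e.linearMapAt ℝ x (s x)) + f x • φ (e.linearMapAt ℝ x (t x))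
    rw [map_add, map_add, smul_add]
  map_smul' c s := by
    ext x
    change f x • φ (e.linearMapAt ℝ x (c x • s x)) = c x • f x • φ (e.linearMapAt ℝ x (s x))
    rw [map_smul, map_smul, smul_comm]

theorem sec_eq_zero_iff_forall_cov {X : Sec n F A} : X = 0 ↔ ∀ γ : Cov n F A, γ X = 0 := by
  refine ⟨fun hX γ => by rw [hX, map_zero], fun h => ?_⟩
  ext x
  let e := trivializationAt F A x
  have hx : x ∈ e.baseSet := FiberBundle.mem_baseSet_trivializationAt' x
  obtain ⟨f, -, hf⟩ := (SmoothBumpFunction.nhds_basis_tsupport (I := 𝓡 n) x).mem_iff.1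
    (e.open_baseSet.mem_nhds hx)
  have he : e.linearMapAt ℝ x (X x) = 0 := by
    refine SeparatingDual.eq_zero_of_forall_dual_eq_zero (R := ℝ) fun φ => ?_
    have hφ : f x • φ (e.linearMapAt ℝ x (X x)) = 0 :=
      congrArg (fun g : SmoothFn n M => g x) (h (cutoffCov e ⟨f, f.contMDiff⟩ hf φ))
    simpa using hφ
  calc X x = e.symmₗ ℝ x (e.linearMapAt ℝ x (X x)) := (e.symmₗ_linearMapAt hx (X x)).symm
    _ = 0 := by rw [he, map_zero]

theorem genSec_eq_zero_of_forall_pairing {u : GenSec n F A} (h : ∀ v, pairing u v = 0) :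
    u = 0 := by
  refine Prod.ext (sec_eq_zero_iff_forall_cov.2 fun γ => ?_) (LinearMap.ext fun Z => ?_)
  · simpa [pairing] using h (0, γ)
  · simpa [pairing] using h (Z, 0)

namespace SkewAlgebroid

variable {B : SkewAlgebroid n F A} {H : ThreeForm n F A}

theorem isPoisson_iff {π : Bivector n F A} :
    B.IsPoisson π ↔
      ∀ α β, B.bracket (π.sharp α) (π.sharp β) - π.sharp (B.piBracket π α β) = 0 := by
  simp only [IsPoisson, schouten_self, smul_eq_zero_iff_right (two_ne_zero (α := ℝ)),
    sec_eq_zero_iff_forall_cov]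

theorem forall_courantTorsion_cov_cov_eq_zero_iff {π : Bivector n F A} {N : Endo n F A}
    {σ : TwoForm n F A} (hc : ∀ α, N (π.sharp α) = π.sharp (N.transpose α)) :
    (∀ α β, B.courantTorsion H (matrixEndo π N σ) (0, α) (0, β) = 0) ↔
      B.IsPoisson π ∧
      ∀ α β, B.concomitant π N α β = (2 : ℝ) • H.toLin (π.sharp α) (π.sharp β) := by
  simp only [courantTorsion_cov_cov, Prod.mk_eq_zero, forall_and, isPoisson_iff,
    concomitant_eq_two_smul B hc, sub_eq_zero (b := H.toLin _ _),
    (smul_right_injective (Cov n F A) (two_ne_zero (α := ℝ))).eq_iff]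

theorem courantTorsion_eq_zero {lam : ℝ} {J : GenSec n F A →ₗ[SmoothFn n M] GenSec n F A}
    (ho : ∀ u v, pairing (J u) v + pairing u (J v) = 0) (hs : ∀ u, J (J u) = lam • u)
    (hsec : ∀ X Y : Sec n F A, B.courantTorsion H J (X, 0) (Y, 0) = 0)
    (hcov : ∀ α β : Cov n F A, B.courantTorsion H J (0, α) (0, β) = 0) (u v : GenSec n F A) :
    B.courantTorsion H J u v = 0 := by
  have decomp (u : GenSec n F A) : u = (u.1, 0) + (0, u.2) := by simp
  have zero_pairing (w : GenSec n F A) : pairing 0 w = 0 := by simp [pairing]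
  have hmixed (X : Sec n F A) (β : Cov n F A) : B.courantTorsion H J (X, 0) (0, β) = 0 := by
    refine genSec_eq_zero_of_forall_pairing fun w => ?_
    have against_sec : pairing (B.courantTorsion H J (X, 0) (0, β)) (w.1, 0) = 0 := by
      rw [pairing_courantTorsion_swap ho hs, hsec, zero_pairing, neg_zero]
    have against_cov : pairing (B.courantTorsion H J (X, 0) (0, β)) (0, w.2) = 0 := by
      rw [courantTorsion_swap ho hs, pairing_neg_left, pairing_courantTorsion_swap ho hs, hcov,
        zero_pairing, neg_zero, neg_zero]
    rw [decomp w, pairing_add_right, against_sec, against_cov, add_zero]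
  rw [decomp u, decomp v, courantTorsion_add_left, courantTorsion_add_right,
    courantTorsion_add_right, hsec, hcov, hmixed, courantTorsion_swap ho hs (0, u.2), hmixed]
  simp only [add_zero, neg_zero]

end SkewAlgebroid

end LieAlgebroidGeometry

theorem mainTheorem3_general {n : ℕ} {M : Type*} [TopologicalSpace M] [T2Space M]
    [ChartedSpace (EuclideanSpace ℝ (Fin n)) M] [IsManifold (𝓡 n) ∞ M]
    {F : Type*} [NormedAddCommGroup F] [NormedSpace ℝ F]
    {A : M → Type*} [TopologicalSpace (Bundle.TotalSpace F A)]
    [∀ x, AddCommGroup (A x)] [∀ x, Module ℝ (A x)] [∀ x, TopologicalSpace (A x)]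
    [FiberBundle F A] [VectorBundle ℝ F A] [ContMDiffVectorBundle ∞ F A (𝓡 n)]
    (μ : LieAlgebroid n F A) (H : ThreeForm n F A) (hH : μ.IsClosed H)
    (π : Bivector n F A) (N : Endo n F A) (σ : TwoForm n F A) (lam : ℝ) :
    ((∀ u, matrixEndo π N σ (matrixEndo π N σ u) = lam • u) ∧
        ∀ u v, μ.courantTorsion H (matrixEndo π N σ) u v = 0) ↔
      μ.IsPoissonQuasiNijenhuis π N (-(μ.d₂ σ)) H ∧
      (∀ X, N (N X) + π.sharp (σ.flat X) = lam • X) ∧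
      (∀ X, σ.flat (N X) = N.transpose (σ.flat X)) ∧
      (∀ X Y Z,
        (2 : ℝ) • (((μ.d₂ σ).contract N).toLin X Y Z - (H.contractTwice N).toLin X Y Z) =
          (μ.d₂ (σ.contract N)).toLin X Y Z + (2 * lam) • H.toLin X Y Z) := by
  constructor
  · rintro ⟨hs, hJ⟩
    obtain ⟨hc, hA, hσ⟩ := matrixEndo_sq_iff.1 hs
    obtain ⟨hP, hC⟩ := (SkewAlgebroid.forall_courantTorsion_cov_cov_eq_zero_iff hc).1
      fun α β => hJ (0, α) (0, β)
    obtain ⟨hT, hdσ⟩ := (μ.forall_courantTorsion_sec_sec_eq_zero_iff H hc hA hσ).1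
      fun X Y => hJ (X, 0) (Y, 0)
    exact ⟨⟨hc, (μ.isClosed_d₂ σ).neg, hH, hP, hC, hT, μ.deform_d₃_neg_d₂ hH hdσ⟩, hA, hσ, hdσ⟩
  · rintro ⟨hQ, hA, hσ, hdσ⟩
    have hs := matrixEndo_sq_iff.2 ⟨hQ.sharp_comm, hA, hσ⟩
    refine ⟨hs, SkewAlgebroid.courantTorsion_eq_zero (orthogonal_matrixEndo π N σ) hs ?_ ?_⟩
    · exact (μ.forall_courantTorsion_sec_sec_eq_zero_iff H hQ.sharp_comm hA hσ).2
        ⟨hQ.torsion_eq, hdσ⟩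
    · exact (SkewAlgebroid.forall_courantTorsion_cov_cov_eq_zero_iff hQ.sharp_comm).2
        ⟨hQ.poisson, hQ.concomitant_eq⟩

theorem mainTheorem3 {n : ℕ} {M : Type*} [TopologicalSpace M] [T2Space M]
    [SecondCountableTopology M] [ChartedSpace (EuclideanSpace ℝ (Fin n)) M]
    [IsManifold (𝓡 n) ∞ M]
    {F : Type*} [NormedAddCommGroup F] [NormedSpace ℝ F] [FiniteDimensional ℝ F]
    {A : M → Type*} [TopologicalSpace (Bundle.TotalSpace F A)]
    [∀ x, AddCommGroup (A x)] [∀ x, Module ℝ (A x)] [∀ x, TopologicalSpace (A x)]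
    [FiberBundle F A] [VectorBundle ℝ F A] [ContMDiffVectorBundle ∞ F A (𝓡 n)]
    (μ : LieAlgebroid n F A)
    (H : ThreeForm n F A) (hH : μ.IsClosed H)
    (π : Bivector n F A) (N : Endo n F A) (σ : TwoForm n F A)
    (lam : ℝ) (hlam : lam = -1 ∨ lam = 0 ∨ lam = 1) :
    μ.IsCPS H lam (matrixEndo π N σ) ↔
      μ.IsPoissonQuasiNijenhuis π N (-(μ.d₂ σ)) H ∧
      (∀ X, N (N X) + π.sharp (σ.flat X) = lam • X) ∧
      (∀ X, σ.flat (N X) = N.transpose (σ.flat X)) ∧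
      (∀ X Y Z,
        (2 : ℝ) • (((μ.d₂ σ).contract N).toLin X Y Z - (H.contractTwice N).toLin X Y Z) =
          (μ.d₂ (σ.contract N)).toLin X Y Z + (2 * lam) • H.toLin X Y Z) :=
  ⟨fun h => (mainTheorem3_general μ H hH π N σ lam).1 ⟨h.sq, h.integrable⟩, fun h =>
    have ⟨hs, hJ⟩ := (mainTheorem3_general μ H hH π N σ lam).2 h
    ⟨hlam, orthogonal_matrixEndo π N σ, hs, hJ⟩⟩
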